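/- Let $A=\{a_0,\dots,a_n\}$ be a set of $n+1\ge 2$ agents. Simplicial models. A simplicial model over a value set $\mathcal V$ is a pure $n$-dimensional simplicial complex with a colouring $\chi$ of its vertices by $A$, injective on every simplex, and a labelling $\ell$ assigning to each vertex $v$ a set $\ell(v)$ of atomic propositions $p_{a,x}$ ($x\in\mathcal V$, "agent $a$ holds value $x$") with $a=\chi(v)$. A morphism of simplicial models is a simplicial map preserving colours and labels. At a facet $X$, the atom $p_{a,x}$ is true iff $p_{a,x}\in\ell(v)$ for some $v\in X$, Boolean connectives are interpreted as usual, and $K_a\varphi$ is true at $X$ iff $\varphi$ is true at every facet $Y$ such that $X\cap Y$ contains a vertex of colour $a$. Action models. A simplicial action model is a pure $n$-dimensional chromatic simplicial complex on the colours $A$ with a precondition formula $\mathsf{pre}(Y)$ for every facet $Y$. The product update $M[\mathcal A]$ of a simplicial model $M$ by an action model $\mathcal A$ is the simplicial model whose simplexes are the non-empty subsets of the sets $X\times Y=\{(u,v): u\in X,\ v\in Y,\ \chi(u)=\chi(v)\}$, where $X$ is a facet of $M$, $Y$ is a facet of $\mathcal A$, and $\mathsf{pre}(Y)$ holds at $X$;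 colours and labels are those of the first component. Let $\pi: M[\mathcal A]\to M$ be the first projection. The input model. $\mathcal I$ has the vertices $\langle a,x\rangle$, $a\in A$, $x\in\{0,1\}$, of colour $a$ and label $\{p_{a,x}\}$, and its facets are the sets $\{\langle a,x_a\rangle: a\in A\}$ for all $x\in\{0,1\}^A$. The one-round immediate snapshot action model $\mathcal{IS}$. For a sequential partition $c=(c_1,\dots,c_m)$ of $A$ (non-empty, pairwise disjoint sets with union $A$), an agent $a\in c_j$ and $x\in\{0,1\}^A$, let $\mathsf{view}_a(c^x)$ be the vector obtained from $x$ by replacing $x_b$ by $\emptyset$ for every $b\notin c_1\cup\dots\cup c_j$. The facets of $\mathcal{IS}$ are the sets $\{\langle a,\mathsf{view}_a(c^x)\rangle: a\in A\}$ for all $c$ and $x$, with $\langle a,\cdot\rangle$ of colour $a$; the precondition of this facet is $\bigwedge_{a\in A}p_{a,x_a}$. The binary consensus task $\mathcal T$ is the action model with exactly two facets $X_d=\{\langle a,d\rangle: a\in A\}$, $d\in\{0,1\}$, with $\langle a,d\rangle$ of colour $a$; the precondition of $X_d$ says that at least one agent has input $d$ (so it holds at every facet of $\mathcal I$ except the one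 where all inputs are $1-d$). Theorem. Binary consensus is not solvable by $\mathcal{IS}$: there is no morphism of simplicial models $\delta:\mathcal I[\mathcal{IS}]\to\mathcal I[\mathcal T]$ with $\pi\circ\delta=\pi$. -/

import Mathlib

namespace EpistemicDEL

/-! Epistemic logic on chromatic simplicial complexes.
The agents are `a₀, …, aₙ`, i.e. the elements of `Fin (n + 1)`. -/

/-- Formulas over the atoms `p_{a,x}`, "agent `a` holds the value `x`". -/
inductive Formula (n : ℕ) (Val : Type*) where
  | atom (a : Fin (n + 1)) (x : Val) : Formula n Val
  | neg (φ : Formula n Val) : Formula n Val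
  | and (φ ψ : Formula n Val) : Formula n Val
  | know (a : Fin (n + 1)) (φ : Formula n Val) : Formula n Val

namespace Formula

/-- The conjunction `φ₀ ∧ (φ₁ ∧ (… ∧ φₖ))`. -/
def conj {n : ℕ} {Val : Type*} : {k : ℕ} → (Fin (k + 1) → Formula n Val) → Formula n Val
  | 0, φ => φ 0
  | _ + 1, φ => .and (φ 0) (conj fun i => φ i.succ)

/-- "Every agent `a` holds the value `x a`." -/
def inputs {n : ℕ} {Val : Type*} (x : Fin (n + 1) → Val) : Formula n Val :=
  conj fun a => .atom a (x a)

/-- "At least one agent holds the value `x`", as a negated conjunction of negations. -/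
def someInput (n : ℕ) {Val : Type*} (x : Val) : Formula n Val :=
  .neg (conj fun a : Fin (n + 1) => .neg (.atom a x))

end Formula

/-- A facet is an inclusion-maximal simplex. -/
def IsFacet {V : Type*} (C : AbstractSimplicialComplex V) (X : Finset V) : Prop :=
  Maximal (fun s => s ∈ C.faces) X

/-- A pure chromatic simplicial complex of dimension `n` with vertex set `V`, coloured by the
`n + 1` agents. -/
structure ChromaticComplex (n : ℕ) (V : Type*) extends AbstractSimplicialComplex V where
  color : V → Fin (n + 1)
  color_injOn : ∀ s ∈ faces, Set.InjOn color (s : Set V)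
  card_facet : ∀ X, IsFacet toAbstractSimplicialComplex X → X.card = n + 1

/-- The facets of a chromatic complex. -/
abbrev ChromaticComplex.Facet {n : ℕ} {V : Type*} (C : ChromaticComplex n V) : Type _ :=
  {X : Finset V // IsFacet C.toAbstractSimplicialComplex X}

/-- A simplicial model; the atom `p_{a,x}` is represented by the pair `(a, x)`. -/
structure SimplicialModel (n : ℕ) (Val V : Type*) extends ChromaticComplex n V where
  label : V → Set (Fin (n + 1) × Val)
  label_local : ∀ v, ∀ p ∈ label v, p.1 = color v

/-- Truth of a formula at a facet of a simplicial model. -/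
def SimplicialModel.Sat {n : ℕ} {Val V : Type*} (M : SimplicialModel n Val V) :
    M.Facet → Formula n Val → Prop
  | X, .atom a x => ∃ v ∈ X.1, (a, x) ∈ M.label v
  | X, .neg φ => ¬ M.Sat X φ
  | X, .and φ ψ => M.Sat X φ ∧ M.Sat X ψ
  | X, .know a φ => ∀ Y : M.Facet, a ∈ M.color '' ((X.1 : Set V) ∩ (Y.1 : Set V)) → M.Sat Y φ

open Classical in
/-- A morphism of simplicial models: a simplicial map preserving colours and labels. -/
@[ext]
structure SimplicialModel.Hom {n : ℕ} {Val V W : Type*}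
    (M : SimplicialModel n Val V) (N : SimplicialModel n Val W) where
  toFun : V → W
  map_simplex : ∀ s ∈ M.faces, s.image toFun ∈ N.faces
  map_color : ∀ v, N.color (toFun v) = M.color v
  map_label : ∀ v, N.label (toFun v) = M.label v

/-- Composition of morphisms: first `f`, then `g`. -/
def SimplicialModel.Hom.comp {n : ℕ} {Val U V W : Type*} {L : SimplicialModel n Val U}
    {M : SimplicialModel n Val V} {N : SimplicialModel n Val W} (g : M.Hom N) (f : L.Hom M) :
    L.Hom N where
  toFun := g.toFun ∘ f.toFun
  map_simplex s hs := by
    classical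
    have h := g.map_simplex _ (f.map_simplex s hs)
    rw [Finset.image_image] at h
    convert h
  map_color v := (g.map_color _).trans (f.map_color v)
  map_label v := (g.map_label _).trans (f.map_label v)

/-- A simplicial action model: every facet (an action) carries a precondition. -/
structure ActionModel (n : ℕ) (Val W : Type*) extends ChromaticComplex n W where
  pre : toChromaticComplex.Facet → Formula n Val

/-- The vertex set of the product `X × Y` of two simplexes: the pairs of a vertex of `X` and
a vertex of `Y` of the same colour. -/
def prodSimplex {n : ℕ} {V W : Type*} (C : ChromaticComplex n V) (T : ChromaticComplex n W)
    (X : Finset V) (Y : Finset W) : Set (V × W) :=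
  {p | p.1 ∈ X ∧ p.2 ∈ Y ∧ C.color p.1 = T.color p.2}

/-- The vertices of `M[A]`: the vertices of the products `X × Y` of a facet `X` of `M` and a facet
`Y` of `A` such that the precondition of `Y` holds in `X`. -/
abbrev UpdateVertex {n : ℕ} {Val V W : Type*} (M : SimplicialModel n Val V)
    (A : ActionModel n Val W) : Type _ :=
  {p : V × W // ∃ (X : M.Facet) (Y : A.Facet),
    M.Sat X (A.pre Y) ∧ p ∈ prodSimplex M.toChromaticComplex A.toChromaticComplex X.1 Y.1}

theorem card_facet_of_exists {n : ℕ} {V : Type*} (C : AbstractSimplicialComplex V)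
    (h : ∀ s ∈ C.faces, ∃ t ∈ C.faces, s ⊆ t ∧ t.card = n + 1) (X : Finset V)
    (hX : IsFacet C X) : X.card = n + 1 := by
  obtain ⟨t, ht, hs, hc⟩ := h X hX.1
  rw [Finset.Subset.antisymm hs (hX.2 ht hs), hc]

theorem ChromaticComplex.exists_color {n : ℕ} {V : Type*} (C : ChromaticComplex n V)
    (X : C.Facet) (a : Fin (n + 1)) : ∃ v ∈ X.1, C.color v = a := by
  classical
  have h1 : (X.1.image C.color).card = Fintype.card (Fin (n + 1)) := by
    rw [Finset.card_image_of_injOn (C.color_injOn _ X.2.1), C.card_facet _ X.2, Fintype.card_fin]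
  have h2 := (Finset.card_eq_iff_eq_univ _).1 h1
  have h3 : a ∈ X.1.image C.color := h2 ▸ Finset.mem_univ a
  simpa using h3

/-- The product update model `M[A]`. Its simplexes are the non-empty subsets of the products
`X × Y` of facets such that the precondition of `Y` holds in `X`; colours and labels are those of
the first component. -/
def SimplicialModel.update {n : ℕ} {Val V W : Type*} (M : SimplicialModel n Val V)
    (A : ActionModel n Val W) : SimplicialModel n Val (UpdateVertex M A) where
  faces := {s | s.Nonempty ∧ ∃ (X : M.Facet) (Y : A.Facet), M.Sat X (A.pre Y) ∧
    ∀ p ∈ s, p.1 ∈ prodSimplex M.toChromaticComplex A.toChromaticComplex X.1 Y.1}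
  isRelLowerSet_faces := by
    rintro s ⟨hs, X, Y, hXY, h⟩
    exact ⟨hs, fun t hts ht => ⟨ht, X, Y, hXY, fun p hp => h p (hts hp)⟩⟩
  singleton_mem := by
    rintro ⟨p, X, Y, hXY, hp⟩
    exact ⟨Finset.singleton_nonempty _, X, Y, hXY, fun q hq => by
      rw [Finset.mem_singleton.1 hq]; exact hp⟩
  color p := M.color p.1.1
  color_injOn := by
    rintro s ⟨-, X, Y, -, h⟩ p hp q hq hpq
    obtain ⟨hp1, hp2, hp3⟩ := h p hp
    obtain ⟨hq1, hq2, hq3⟩ := h q hq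
    have h1 := M.color_injOn _ X.2.1 hp1 hq1 hpq
    have h2 := A.color_injOn _ Y.2.1 hp2 hq2 (hp3.symm.trans (Eq.trans hpq hq3))
    exact Subtype.ext (Prod.ext h1 h2)
  card_facet := by
    apply card_facet_of_exists
    rintro s ⟨-, X, Y, hXY, h⟩
    choose f hf hf' using M.exists_color X
    choose g hg hg' using A.exists_color Y
    have hm : ∀ a, (f a, g a) ∈
        prodSimplex M.toChromaticComplex A.toChromaticComplex X.1 Y.1 :=
      fun a => ⟨hf a, hg a, (hf' a).trans (hg' a).symm⟩
    let e : Fin (n + 1) ↪ UpdateVertex M A :=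
      ⟨fun a => ⟨(f a, g a), X, Y, hXY, hm a⟩, fun a b hab => by
        have h1 : f a = f b := congrArg (fun q : UpdateVertex M A => q.1.1) hab
        rw [← hf' a, ← hf' b, h1]⟩
    refine ⟨Finset.univ.map e, ⟨by simp, X, Y, hXY, ?_⟩, ?_, by simp⟩
    · intro p hp
      obtain ⟨a, -, rfl⟩ := Finset.mem_map.1 hp
      exact hm a
    · intro p hp
      obtain ⟨hp1, hp2, hp3⟩ := h p hp
      refine Finset.mem_map.2 ⟨M.color p.1.1, Finset.mem_univ _, Subtype.ext (Prod.ext ?_ ?_)⟩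
      · exact M.color_injOn _ X.2.1 (hf _) hp1 (hf' _)
      · exact A.color_injOn _ Y.2.1 (hg _) hp2 ((hg' _).trans hp3)
  label p := M.label p.1.1
  label_local p := M.label_local p.1.1

/-- The first projection `π : M[A] → M`. -/
def SimplicialModel.proj {n : ℕ} {Val V W : Type*} (M : SimplicialModel n Val V)
    (A : ActionModel n Val W) : (M.update A).Hom M where
  toFun p := p.1.1
  map_simplex := by
    classical
    rintro s ⟨hs, X, Y, -, h⟩
    refine (M.isRelLowerSet_faces X.2.1).2 ?_ (hs.image _)
    intro v hv
    obtain ⟨p, hp, rfl⟩ := Finset.mem_image.1 hv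
    exact (h p hp).1
  map_color _ := rfl
  map_label _ := rfl

/-- The task `T` is solvable in `A` from the initial model `M` if there is a morphism
`δ : M[A] → M[T]` with `π ∘ δ = π`. -/
def Solvable {n : ℕ} {Val V W₁ W₂ : Type*} (M : SimplicialModel n Val V)
    (A : ActionModel n Val W₁) (T : ActionModel n Val W₂) : Prop :=
  ∃ δ : (M.update A).Hom (M.update T), (M.proj T).comp δ = M.proj A

/-- The vertices `⟨a, f a⟩`, for an agent `a` and an assignment `f ∈ S` of local states. -/
abbrev AssignmentVertex {n : ℕ} {D : Type*} (S : Set (Fin (n + 1) → D)) : Type _ :=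
  {p : Fin (n + 1) × D // ∃ f ∈ S, f p.1 = p.2}

/-- The simplex `{⟨a₀, f a₀⟩, …, ⟨aₙ, f aₙ⟩}`. -/
def graphSimplex {n : ℕ} {D : Type*} (S : Set (Fin (n + 1) → D)) (f : Fin (n + 1) → D)
    (hf : f ∈ S) : Finset (AssignmentVertex S) :=
  Finset.univ.map ⟨fun a => ⟨(a, f a), f, hf, rfl⟩,
    fun _ _ h => congrArg (fun q : AssignmentVertex S => q.1.1) h⟩

theorem mem_graphSimplex {n : ℕ} {D : Type*} {S : Set (Fin (n + 1) → D)} {f : Fin (n + 1) → D}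
    {hf : f ∈ S} {p : AssignmentVertex S} : p ∈ graphSimplex S f hf ↔ f p.1.1 = p.1.2 := by
  constructor
  · intro hp
    obtain ⟨a, -, rfl⟩ := Finset.mem_map.1 hp
    rfl
  · intro hp
    exact Finset.mem_map.2 ⟨p.1.1, Finset.mem_univ _, Subtype.ext (Prod.ext rfl hp)⟩

/-- The chromatic complex whose facets are `{⟨a₀, f a₀⟩, …, ⟨aₙ, f aₙ⟩}` for `f ∈ S`; the vertex
`⟨a, d⟩` has colour `a`. -/
def assignmentComplex {n : ℕ} {D : Type*} (S : Set (Fin (n + 1) → D)) :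
    ChromaticComplex n (AssignmentVertex S) where
  faces := {s | s.Nonempty ∧ ∃ (f : Fin (n + 1) → D) (hf : f ∈ S), s ⊆ graphSimplex S f hf}
  isRelLowerSet_faces := by
    rintro s ⟨hs, f, hf, h⟩
    exact ⟨hs, fun t hts ht => ⟨ht, f, hf, Finset.Subset.trans hts h⟩⟩
  singleton_mem := by
    rintro ⟨p, f, hf, hp⟩
    exact ⟨Finset.singleton_nonempty _, f, hf, by
      rw [Finset.singleton_subset_iff, mem_graphSimplex]; exact hp⟩
  color p := p.1.1
  color_injOn := by
    rintro s ⟨-, f, hf, h⟩ p hp q hq hpq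
    have h1 := mem_graphSimplex.1 (h hp)
    have h2 := mem_graphSimplex.1 (h hq)
    have hpq' : p.1.1 = q.1.1 := hpq
    exact Subtype.ext (Prod.ext hpq' (by rw [← h1, ← h2, hpq']))
  card_facet := by
    apply card_facet_of_exists
    rintro s ⟨-, f, hf, h⟩
    exact ⟨_, ⟨by simp [graphSimplex], f, hf, Finset.Subset.refl _⟩, h, by simp [graphSimplex]⟩

/-- The facets of `assignmentComplex S` are exactly the simplexes `{⟨a, f a⟩}`, `f ∈ S`. -/
theorem isFacet_iff {n : ℕ} {D : Type*} {S : Set (Fin (n + 1) → D)}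
    {X : Finset (AssignmentVertex S)} :
    IsFacet (assignmentComplex S).toAbstractSimplicialComplex X ↔
      ∃ (f : Fin (n + 1) → D) (hf : f ∈ S), X = graphSimplex S f hf := by
  constructor
  · intro hX
    obtain ⟨f, hf, h⟩ := hX.1.2
    have hm : graphSimplex S f hf ∈ (assignmentComplex S).faces :=
      ⟨by simp [graphSimplex], f, hf, Finset.Subset.refl _⟩
    exact ⟨f, hf, Finset.Subset.antisymm h (hX.2 hm h)⟩
  · rintro ⟨f, hf, rfl⟩
    refine ⟨⟨by simp [graphSimplex], f, hf, Finset.Subset.refl _⟩, ?_⟩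
    rintro s ⟨-, g, hg, h⟩ hs
    have := Finset.eq_of_subset_of_card_le (Finset.Subset.trans hs h) (by simp [graphSimplex])
    exact this ▸ h

/-- The assignment `f` of a facet `{⟨a₀, f a₀⟩, …, ⟨aₙ, f aₙ⟩}`. -/
noncomputable def assignment {n : ℕ} {D : Type*} {S : Set (Fin (n + 1) → D)}
    (X : (assignmentComplex S).Facet) : Fin (n + 1) → D :=
  (isFacet_iff.1 X.2).choose

theorem assignment_mem {n : ℕ} {D : Type*} {S : Set (Fin (n + 1) → D)}
    (X : (assignmentComplex S).Facet) : assignment X ∈ S :=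
  (isFacet_iff.1 X.2).choose_spec.choose

/-- The initial model: every agent holds an arbitrary value; its vertices are the pairs `⟨a, x⟩`,
labelled by `{p_{a,x}}`. -/
def inputModel (n : ℕ) (Val : Type*) :
    SimplicialModel n Val (AssignmentVertex (Set.univ : Set (Fin (n + 1) → Val))) where
  toChromaticComplex := assignmentComplex Set.univ
  label p := {p.1}
  label_local p q hq := by rw [Set.mem_singleton_iff.1 hq]; rfl

/-- A sequential partition `c₁, …, cₘ` of the agents into concurrency classes. -/
structure SeqPartition (n : ℕ) where
  classes : List (Finset (Fin (n + 1)))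
  nonempty : ∀ c ∈ classes, c.Nonempty
  disjoint : classes.Pairwise Disjoint
  cover : ∀ a, ∃ c ∈ classes, a ∈ c

/-- The agents seen by `a`: if `a ∈ cⱼ`, the union of the `cᵢ` with `i ≤ j`. -/
def SeqPartition.aview {n : ℕ} (c : SeqPartition n) (a : Fin (n + 1)) : Set (Fin (n + 1)) :=
  {b | ∃ i j : Fin c.classes.length, i ≤ j ∧ a ∈ c.classes.get j ∧ b ∈ c.classes.get i}

open Classical in
/-- The view of `a` in the action `c^x`: the vector `x`, with the values of the agents that `a` does
not see replaced by `none`. -/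
noncomputable def view {n : ℕ} {Val : Type*} (c : SeqPartition n) (x : Fin (n + 1) → Val)
    (a : Fin (n + 1)) : Fin (n + 1) → Option Val :=
  fun b => if b ∈ c.aview a then some (x b) else none

/-- The families of views `(view_a(c^x))_a`, over all actions `c^x`. -/
def viewFamilies (n : ℕ) (Val : Type*) : Set (Fin (n + 1) → Fin (n + 1) → Option Val) :=
  {f | ∃ (c : SeqPartition n) (x : Fin (n + 1) → Val), f = view c x}

/-- The input vector `x` of the action `c^x`. -/
noncomputable def actionInput {n : ℕ} {Val : Type*}
    (Y : (assignmentComplex (viewFamilies n Val)).Facet) : Fin (n + 1) → Val :=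
  (assignment_mem Y).choose_spec.choose

/-- The immediate snapshot action model: the facets are `{⟨a, view_a(c^x)⟩ : a}` over all
sequential partitions `c` and input vectors `x`, and the precondition of `c^x` says that the input
vector is `x`. -/
noncomputable def immediateSnapshot (n : ℕ) (Val : Type*) :
    ActionModel n Val (AssignmentVertex (viewFamilies n Val)) where
  toChromaticComplex := assignmentComplex (viewFamilies n Val)
  pre Y := .inputs (actionInput Y)

/-- The binary consensus task: its two facets are `X₀`, where all decisions are `0`, and `X₁`, where
all decisions are `1`; the precondition of `X_d` says that at least one agent has input `d`. -/
noncomputable def binaryConsensus (n : ℕ) :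
    ActionModel n (Fin 2)
      (AssignmentVertex {f : Fin (n + 1) → Fin 2 | ∃ d, f = fun _ => d}) where
  toChromaticComplex := assignmentComplex _
  pre Y := .someInput n (assignment Y 0)

/-- The input vector of an action does not depend on choices: the facet of `c^x` determines `x`. -/
theorem actionInput_eq {n : ℕ} {Val : Type*}
    (Y : (assignmentComplex (viewFamilies n Val)).Facet) (c : SeqPartition n)
    (x : Fin (n + 1) → Val) (hf : view c x ∈ viewFamilies n Val)
    (hY : Y.1 = graphSimplex _ (view c x) hf) :
    actionInput Y = x := by
  have h1 : assignment Y = view c x := by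
    have h := (isFacet_iff.1 Y.2).choose_spec.choose_spec
    funext a
    have hm : (⟨(a, view c x a), view c x, ⟨c, x, rfl⟩, rfl⟩ :
        AssignmentVertex (viewFamilies n Val)) ∈ Y.1 := by
      rw [hY, mem_graphSimplex]
    rw [h, mem_graphSimplex] at hm
    exact hm
  have h2 : assignment Y = view (assignment_mem Y).choose (actionInput Y) :=
    (assignment_mem Y).choose_spec.choose_spec
  have own : ∀ (c : SeqPartition n) (a : Fin (n + 1)), a ∈ c.aview a := by
    intro c a
    obtain ⟨s, hs, ha⟩ := c.cover a
    obtain ⟨i, hi⟩ := List.get_of_mem hs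
    exact ⟨i, i, le_rfl, hi ▸ ha, hi ▸ ha⟩
  funext a
  have h3 := congrFun (congrFun (h2.symm.trans h1) a) a
  simpa [view, own] using h3

end EpistemicDEL

namespace EpistemicDEL

/-! A solution `δ` gives every execution `c^x` one common decision, which is the input of some agent
(`exists_decision`). An agent's vertex in `I[IS]` is determined by its view
(`snapshotVertex_congr`), so two executions that share the view of a single agent have the same
decision.

It remains to connect the all-0 and all-1 inputs by such steps. Starting from the fully concurrent
schedule, move an agent `b` to the end: `b` sees everything both before and after, so the decision
is kept. Now every other agent misses the input of `b`, so that input may be flipped; then return to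
the concurrent schedule. Flipping all inputs one at a time makes the decisions at all-0 and all-1
equal, against validity. -/

theorem SimplicialModel.sat_conj {n : ℕ} {Val V : Type*} (M : SimplicialModel n Val V)
    (X : M.Facet) : ∀ {k : ℕ} (φ : Fin (k + 1) → Formula n Val),
      M.Sat X (Formula.conj φ) ↔ ∀ i, M.Sat X (φ i)
  | 0, φ => by simp [Formula.conj]
  | k + 1, φ => by
    simp only [Formula.conj, SimplicialModel.Sat]
    rw [M.sat_conj X, Fin.forall_fin_succ (P := fun i => M.Sat X (φ i))]

theorem SimplicialModel.sat_someInput {n : ℕ} {Val V : Type*} (M : SimplicialModel n Val V)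
    (X : M.Facet) (d : Val) :
    M.Sat X (Formula.someInput n d) ↔ ∃ a, M.Sat X (.atom a d) := by
  rw [Formula.someInput, SimplicialModel.Sat, M.sat_conj]
  simp [SimplicialModel.Sat]

/-! ### Facets of assignment complexes, truth in the input model and views -/

/-- The facet `{⟨a, f a⟩}` of an assignment complex. -/
def graphFacet {n : ℕ} {D : Type*} (S : Set (Fin (n + 1) → D)) (f : Fin (n + 1) → D)
    (hf : f ∈ S) : (assignmentComplex S).Facet :=
  ⟨graphSimplex S f hf, isFacet_iff.2 ⟨f, hf, rfl⟩⟩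

theorem mem_facet_iff {n : ℕ} {D : Type*} {S : Set (Fin (n + 1) → D)}
    (X : (assignmentComplex S).Facet) (p : AssignmentVertex S) :
    p ∈ X.1 ↔ assignment X p.1.1 = p.1.2 := by
  have h := (isFacet_iff.1 X.2).choose_spec.choose_spec
  rw [h, mem_graphSimplex]
  rfl

theorem sat_atom_inputModel {n : ℕ} {Val : Type*} (X : (inputModel n Val).Facet)
    (a : Fin (n + 1)) (d : Val) :
    (inputModel n Val).Sat X (.atom a d) ↔ assignment X a = d := by
  rw [SimplicialModel.Sat]
  constructor
  · rintro ⟨v, hv, hl⟩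
    have h := (mem_facet_iff X v).1 hv
    have hl' : (a, d) = v.1 := hl
    rw [← hl'] at h
    exact h
  · intro h
    exact ⟨⟨(a, d), assignment X, Set.mem_univ _, h⟩, (mem_facet_iff X _).2 h, rfl⟩

theorem SeqPartition.self_mem_aview {n : ℕ} (c : SeqPartition n) (a : Fin (n + 1)) :
    a ∈ c.aview a := by
  obtain ⟨s, hs, ha⟩ := c.cover a
  obtain ⟨i, hi⟩ := List.get_of_mem hs
  exact ⟨i, i, le_rfl, hi ▸ ha, hi ▸ ha⟩

/-- An agent always sees itself, so its own input can be read off its view. -/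
theorem eq_of_view_eq {n : ℕ} {Val : Type*} {c c' : SeqPartition n} {x x' : Fin (n + 1) → Val}
    {a : Fin (n + 1)} (h : view c x a = view c' x' a) : x a = x' a := by
  have := congrFun h a
  simpa [view, SeqPartition.self_mem_aview] using this

theorem mem_viewFamilies {n : ℕ} {Val : Type*} (c : SeqPartition n) (x : Fin (n + 1) → Val) :
    view c x ∈ viewFamilies n Val :=
  ⟨c, x, rfl⟩

theorem sat_pre_immediateSnapshot {n : ℕ} {Val : Type*} (c : SeqPartition n)
    (x : Fin (n + 1) → Val) :
    (inputModel n Val).Sat (graphFacet _ x (Set.mem_univ _))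
      ((immediateSnapshot n Val).pre (graphFacet _ (view c x) (mem_viewFamilies c x))) := by
  have h : actionInput (graphFacet _ (view c x) (mem_viewFamilies c x)) = x :=
    actionInput_eq _ c x (mem_viewFamilies c x) rfl
  change (inputModel n Val).Sat _ (.inputs (actionInput _))
  rw [h]
  exact ((inputModel n Val).sat_conj _ _).2 fun a =>
    (sat_atom_inputModel _ a (x a)).2 ((mem_facet_iff (graphFacet _ x (Set.mem_univ _))
      ⟨(a, x a), x, Set.mem_univ _, rfl⟩).1 ((mem_graphSimplex (hf := Set.mem_univ x)).2 rfl))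

/-! ### Executions as simplexes of `I[IS]`, and their decisions -/

/-- The vertex of colour `a` of the facet of `I[IS]` given by the action `c^x`. -/
noncomputable def snapshotVertex {n : ℕ} {Val : Type*} (c : SeqPartition n)
    (x : Fin (n + 1) → Val) (a : Fin (n + 1)) :
    UpdateVertex (inputModel n Val) (immediateSnapshot n Val) :=
  ⟨(⟨(a, x a), x, Set.mem_univ _, rfl⟩, ⟨(a, view c x a), view c x, mem_viewFamilies c x, rfl⟩),
    graphFacet _ x (Set.mem_univ _), graphFacet _ (view c x) (mem_viewFamilies c x),
    sat_pre_immediateSnapshot c x,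
    (mem_graphSimplex (hf := Set.mem_univ x)).2 rfl,
    (mem_graphSimplex (hf := mem_viewFamilies c x)).2 rfl, rfl⟩

/-- The view fixes the second component, and through the agent's own entry also the first.
Executions indistinguishable to `a` thus share a vertex, on which `δ` takes a single value. -/
theorem snapshotVertex_congr {n : ℕ} {Val : Type*} {c c' : SeqPartition n}
    {x x' : Fin (n + 1) → Val} {a : Fin (n + 1)} (h : view c x a = view c' x' a) :
    snapshotVertex c x a = snapshotVertex c' x' a := by
  apply Subtype.ext
  simp [snapshotVertex, h, eq_of_view_eq h]

theorem image_snapshotVertex_mem_faces {n : ℕ} {Val : Type*}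
    [DecidableEq (UpdateVertex (inputModel n Val) (immediateSnapshot n Val))] (c : SeqPartition n)
    (x : Fin (n + 1) → Val) :
    Finset.univ.image (snapshotVertex c x) ∈
      ((inputModel n Val).update (immediateSnapshot n Val)).faces := by
  refine ⟨Finset.univ_nonempty.image _, graphFacet _ x (Set.mem_univ _),
    graphFacet _ (view c x) (mem_viewFamilies c x), sat_pre_immediateSnapshot c x, ?_⟩
  intro p hp
  obtain ⟨a, -, rfl⟩ := Finset.mem_image.1 hp
  exact ⟨(mem_graphSimplex (hf := Set.mem_univ x)).2 rfl,
    (mem_graphSimplex (hf := mem_viewFamilies c x)).2 rfl, rfl⟩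

/-- Agreement and validity: all agents decide the same value in `c^x`, and it is the input of
some agent. -/
theorem exists_decision {n : ℕ}
    (δ : ((inputModel n (Fin 2)).update (immediateSnapshot n (Fin 2))).Hom
      ((inputModel n (Fin 2)).update (binaryConsensus n)))
    (hδ : ((inputModel n (Fin 2)).proj (binaryConsensus n)).comp δ =
      (inputModel n (Fin 2)).proj (immediateSnapshot n (Fin 2)))
    (c : SeqPartition n) (x : Fin (n + 1) → Fin 2) :
    ∃ b, ∀ a, (δ.toFun (snapshotVertex c x a)).1.2.1.2 = x b := by
  classical
  obtain ⟨-, X, Y, hXY, h⟩ := δ.map_simplex _ (image_snapshotVertex_mem_faces c x)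
  have hmem : ∀ a, (δ.toFun (snapshotVertex c x a)).1 ∈
      prodSimplex (inputModel n (Fin 2)).toChromaticComplex
        (binaryConsensus n).toChromaticComplex X.1 Y.1 := fun a =>
    h _ (@Finset.mem_image_of_mem _ _ (fun _ _ => Classical.propDecidable _) _ _ _ (Finset.mem_image_of_mem _ (Finset.mem_univ a)))
  -- Since `π ∘ δ = π`, the input facet under the image simplex is still that of `x`.
  have hX : ∀ a, assignment X a = x a := by
    intro a
    have h1 : (δ.toFun (snapshotVertex c x a)).1.1 = (snapshotVertex c x a).1.1 :=
      congrFun (congrArg SimplicialModel.Hom.toFun hδ) (snapshotVertex c x a)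
    have h2 := (mem_facet_iff X _).1 (hmem a).1
    rw [h1] at h2
    exact h2
  obtain ⟨b, hb⟩ := ((inputModel n (Fin 2)).sat_someInput X (assignment Y 0)).1 hXY
  rw [sat_atom_inputModel, hX] at hb
  refine ⟨b, fun a => ?_⟩
  -- Agreement: the assignment of a consensus facet is constant, so its value at agent `0`, used in
  -- the precondition, is everyone's decision.
  obtain ⟨d, hd⟩ := assignment_mem Y
  have h2 := (mem_facet_iff Y _).1 (hmem a).2.1
  rw [hb, ← h2, hd]

/-! ### Two schedules and who sees whom in them -/

/-- The sequential partition in which all agents are concurrent. -/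
def SeqPartition.single (n : ℕ) : SeqPartition n where
  classes := [Finset.univ]
  nonempty := by simp
  disjoint := by simp
  cover := by simp

/-- The sequential partition in which `b` comes after all other agents. -/
def SeqPartition.last {n : ℕ} (a b : Fin (n + 1)) (hab : a ≠ b) : SeqPartition n where
  classes := [{b}ᶜ, {b}]
  nonempty := by
    intro c hc
    simp only [List.mem_cons, List.not_mem_nil, or_false] at hc
    rcases hc with rfl | rfl
    · exact ⟨a, by simpa using hab⟩
    · simp
  disjoint := by simp
  cover d := by simpa using ne_or_eq d b

theorem SeqPartition.aview_single {n : ℕ} (a : Fin (n + 1)) :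
    (SeqPartition.single n).aview a = Set.univ := by
  ext d
  simp only [Set.mem_univ, iff_true]
  exact ⟨⟨0, by simp [single]⟩, ⟨0, by simp [single]⟩, le_rfl, by simp [single], by simp [single]⟩

theorem SeqPartition.aview_last_self {n : ℕ} {a b : Fin (n + 1)} (hab : a ≠ b) :
    (SeqPartition.last a b hab).aview b = Set.univ := by
  ext d
  simp only [Set.mem_univ, iff_true]
  rcases ne_or_eq d b with h | h
  · exact ⟨⟨0, by simp [last]⟩, ⟨1, by simp [last]⟩, by simp, by simp [last], by simp [last, h]⟩
  · exact ⟨⟨1, by simp [last]⟩, ⟨1, by simp [last]⟩, le_rfl, by simp [last], by simp [last, h]⟩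

/-- The only class containing `b` comes strictly after the only class containing `a`. -/
theorem SeqPartition.notMem_aview_last {n : ℕ} {a b : Fin (n + 1)} (hab : a ≠ b) :
    b ∉ (SeqPartition.last a b hab).aview a := by
  rintro ⟨⟨i, hi⟩, ⟨j, hj⟩, hij, ha, hb⟩
  simp only [last, List.length_cons, List.length_nil] at hi hj
  simp only [last] at hij ha hb
  interval_cases i <;> interval_cases j <;> simp_all

end EpistemicDEL

open EpistemicDEL in
theorem mainTheorem3 (n : ℕ) (hn : 1 ≤ n) :
    ¬ EpistemicDEL.Solvable (EpistemicDEL.inputModel n (Fin 2))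
      (EpistemicDEL.immediateSnapshot n (Fin 2)) (EpistemicDEL.binaryConsensus n) := by
  classical
  rintro ⟨δ, hδ⟩
  choose w hw using fun c x => exists_decision δ hδ c x
  -- the common decision in `c^x`
  let D : SeqPartition n → (Fin (n + 1) → Fin 2) → Fin 2 := fun c x => x (w c x)
  have key : ∀ {c c' x x'} (a), view c x a = view c' x' a → D c x = D c' x' := by
    intro c c' x x' a h
    change x (w c x) = x' (w c' x')
    rw [← hw c x a, ← hw c' x' a, snapshotVertex_congr h]
  have hlast : ∀ (a b : Fin (n + 1)) (hab : a ≠ b) x,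
      D (.single n) x = D (.last a b hab) x := by
    intro a b hab x
    -- Agent `b` sees all inputs under both schedules.
    refine key b ?_
    funext d
    simp only [view, SeqPartition.aview_single, SeqPartition.aview_last_self]
  have hflip : ∀ (b : Fin (n + 1)) x v,
      D (.single n) (Function.update x b v) = D (.single n) x := by
    intro b x v
    -- A second agent is needed as the witness that does not notice the flip.
    have : Nontrivial (Fin (n + 1)) := Fin.nontrivial_iff_two_le.2 (by omega)
    obtain ⟨a, hab⟩ := exists_ne b
    rw [hlast a b hab, hlast a b hab]
    refine key a ?_
    funext d
    rcases eq_or_ne d b with rfl | hd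
    · simp [view, SeqPartition.notMem_aview_last hab]
    · simp [view, hd]
  -- Here `s` is the set of agents whose input has been flipped to 1.
  have hall : ∀ s : Finset (Fin (n + 1)),
      D (.single n) (s.piecewise (fun _ => 1) fun _ => 0) = D (.single n) fun _ => 0 := by
    intro s
    induction s using Finset.induction_on with
    | empty => simp
    | insert b s _ ih => rw [Finset.piecewise_insert, hflip, ih]
  have h := hall Finset.univ
  rw [Finset.piecewise_univ] at h
  -- `D` returns an entry of the input vector, so on constant vectors `h` reduces to `1 = 0`.
  exact one_ne_zero h
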